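/- For integers $m\ge 1$ and $k\ge 0$, a proper $m$-fold colouring of the plane with $k$ colours is a map $c$ that assigns to each point $x$ of the Euclidean plane $\mathbb{R}^2$ a set $c(x)\subseteq\{1,\dots,k\}$ of exactly $m$ colours, such that $c(x)\cap c(y)=\emptyset$ whenever $|x-y|=1$. The $m$-fold chromatic number of the plane, $\chi_m$, is the smallest $k$ for which such a colouring exists. 1. For every integer $m\ge 1$ the number $\chi_m$ exists (is finite), and $$\chi_m<\Bigl(1+\frac{2}{\sqrt3}\Bigr)^2 m+3.501 .$$ 2. For all integers $m_1,m_2\ge 1$, $\chi_{m_1+m_2}\le\chi_{m_1}+\chi_{m_2}$. 3. There is a proper $860$-fold colouring of the plane with $3990$ colours, that is, $\chi_{860}\le 3990$, and $\frac{3990}{860}<\bigl(1+\frac{2}{\sqrt3}\bigr)^2$. -/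

import Mathlib

/-- The Euclidean plane. -/
abbrev Plane : Type := EuclideanSpace ℝ (Fin 2)

/-- `c` assigns to each point of the plane a set of exactly `m` of the `k` available colours,
and the sets of any two points at unit distance have no common colour. -/
def IsMFoldColoring (m k : ℕ) (c : Plane → Finset (Fin k)) : Prop :=
  (∀ x, (c x).card = m) ∧ ∀ x y, dist x y = 1 → Disjoint (c x) (c y)

/-- The numbers `k` of colours that suffice for a proper `m`-fold colouring of the plane. -/
def sufficientColors (m : ℕ) : Set ℕ :=
  {k | ∃ c : Plane → Finset (Fin k), IsMFoldColoring m k c}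

/-- The `m`-fold chromatic number of the plane: the smallest sufficient number of colours. -/
noncomputable def multiChromaticNumber (m : ℕ) : ℕ :=
  sInf (sufficientColors m)

/-!
Every colour class used below is a translate of one set: a convex body `B`, the intersection of an
open disc of diameter one with three strips, repeated along a lattice `L`. The translates are those
by the points of a lattice `M ⊇ L` with `M / L` cyclic of order `k`, so there are `k` colours.

* A class contains no two points at distance one: `B` has no such pair, and `B` and `B + ℓ` with
  `ℓ ∈ L` nonzero are more than one apart, either because `ℓ` has length at least two or because
  one of the strips separates them (`LatticeColoring.eq_of_color_eq`).
* A point `x` lies in as many classes as there are points of `M` in `x - B`. If this number is at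
  least `m` for all `x`, then choosing `m` of the classes at each point gives a proper `m`-fold
  colouring. By periodicity and convexity it is enough to look at the finitely many cells of a
  subdivision of a fundamental parallelogram of `M`, and at the four corners of each translated
  cell (`LatticeColoring.exists_sites`).

With integer coordinates both conditions are finite computations, and
`LatticeColoring.mem_sufficientColors` turns them into a colouring. Hexagonal bodies only reach the
ratio `(1 + 2 / √3) ^ 2 ≈ 4.6427` of `k` to `m`, whereas hexagons with rounded corners go below it:
`m = 24` is possible with `k = 111` colours, and `111 / 24 = 4.625`. Explicit lattices for
`m = 1, …, 24` therefore settle every `m`: the disjoint union of colourings makes `χ` subadditive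
(`sufficientColors_add`), and removing `24` from `m` lowers the upper bound by more than `111`.
Likewise `860 = 35 * 24 + 20` and `35 * 111 + 96 = 3981 ≤ 3990`.
-/

/-! ### Combining colourings -/

theorem sufficientColors_mono {m k k' : ℕ} (h : k ∈ sufficientColors m) (hk : k ≤ k') :
    k' ∈ sufficientColors m := by
  obtain ⟨c, hcard, hdisj⟩ := h
  refine ⟨fun x => (c x).map (Fin.castLEEmb hk), fun x => ?_, fun x y hxy => ?_⟩
  · rw [Finset.card_map, hcard]
  · exact (Finset.disjoint_map _).2 (hdisj x y hxy)

theorem sufficientColors_add {m₁ m₂ k₁ k₂ : ℕ} (h₁ : k₁ ∈ sufficientColors m₁)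
    (h₂ : k₂ ∈ sufficientColors m₂) : k₁ + k₂ ∈ sufficientColors (m₁ + m₂) := by
  obtain ⟨c₁, hcard₁, hdisj₁⟩ := h₁
  obtain ⟨c₂, hcard₂, hdisj₂⟩ := h₂
  refine ⟨fun x => ((c₁ x).disjSum (c₂ x)).map finSumFinEquiv.toEmbedding, fun x => ?_,
    fun x y hxy => ?_⟩
  · rw [Finset.card_map, Finset.card_disjSum, hcard₁, hcard₂]
  · rw [Finset.disjoint_map, Finset.disjoint_left]
    rintro (t | t) hx hy
    · simp only [Finset.inl_mem_disjSum] at hx hy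
      exact Finset.disjoint_left.1 (hdisj₁ x y hxy) hx hy
    · simp only [Finset.inr_mem_disjSum] at hx hy
      exact Finset.disjoint_left.1 (hdisj₂ x y hxy) hx hy

theorem sufficientColors_mul {m k : ℕ} (h : k ∈ sufficientColors m) (n : ℕ) :
    n * k ∈ sufficientColors (n * m) := by
  induction n with
  | zero =>
    simp only [zero_mul]
    exact ⟨fun _ => ∅, fun _ => rfl, fun _ _ _ => Finset.disjoint_empty_left _⟩
  | succ n ih =>
    rw [Nat.succ_mul, Nat.succ_mul]
    exact sufficientColors_add ih h

/-! ### Coordinates in the Euclidean plane -/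

theorem plane_ext {x y : Plane} (h0 : x 0 = y 0) (h1 : x 1 = y 1) : x = y := by
  ext i; fin_cases i <;> assumption

theorem plane_norm_sq (x : Plane) : ‖x‖ ^ 2 = x 0 ^ 2 + x 1 ^ 2 := by
  simp [EuclideanSpace.real_norm_sq_eq]

theorem abs_pairing_le (a b : ℝ) (x : Plane) :
    |a * x 0 + b * x 1| ≤ √(a ^ 2 + b ^ 2) * ‖x‖ := by
  apply abs_le_of_sq_le_sq _ (by positivity)
  rw [mul_pow, Real.sq_sqrt (by positivity), plane_norm_sq]
  nlinarith [sq_nonneg (a * x 1 - b * x 0)]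

/-! ### Integer data of a lattice colouring and the finite checks -/

/-- Integer data describing a colouring by translates of a periodically repeated convex body.
All lengths are multiplied by `R`, so that unit distance becomes `R`. The data are arbitrary
numbers; that they give a proper colouring is what `LatticeColoring.check` verifies. -/
structure LatticeColoring where
  /-- The number of colours. -/
  k : ℕ
  /-- The number of colours at each point. -/
  m : ℕ
  /-- The number of parts into which each side of a fundamental parallelogram of the lattice of
  translations is divided. -/
  N : ℕ
  /-- The length standing for unit distance. -/
  R : ℕ
  /-- The first basis vector of the fine grid; `N • u` is a basis vector of the lattice of
  translations. -/
  u : ℤ × ℤ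
  /-- The second basis vector of the fine grid. -/
  v : ℤ × ℤ
  /-- The colour of `N • u`, modulo `k`. -/
  s : ℤ
  /-- The colour of `N • v`, modulo `k`. -/
  t : ℤ
  /-- Triples `(a, b, c)` standing for the strips `|a * x + b * y| ≤ c`. -/
  strips : List (ℤ × ℤ × ℕ)
  /-- A bound on the coordinates of the lattice points of length less than `2 * R`. -/
  a : ℕ
  /-- The bound on the coordinates of the translations used to cover a fundamental
  parallelogram. -/
  w : ℕ

namespace LatticeColoring

/-- `f n`. The case distinction makes kernel reduction evaluate `n` before it is substituted. -/
def force (n : ℕ) (f : ℕ → Bool) : Bool :=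
  match n with
  | 0 => f 0
  | k + 1 => f (k + 1)

/-- `f z`, with `z` evaluated first as in `force`. -/
def forceInt (z : ℤ) (f : ℤ → Bool) : Bool :=
  match z with
  | .ofNat n => force n fun n => f (.ofNat n)
  | .negSucc n => force n fun n => f (.negSucc n)

theorem forceInt_eq (z : ℤ) (f : ℤ → Bool) : forceInt z f = f z := by
  rcases z with (_ | _) | (_ | _) <;> rfl

variable (C : LatticeColoring)

/-- The abscissa of the grid point with coordinates `I`, `J`. -/
def gridX (I J : ℤ) : ℤ := I * C.u.1 + J * C.v.1

/-- The ordinate of the grid point with coordinates `I`, `J`. -/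
def gridY (I J : ℤ) : ℤ := I * C.u.2 + J * C.v.2

/-- The determinant of the basis of the fine grid. -/
def det : ℤ := C.u.1 * C.v.2 - C.u.2 * C.v.1

/-- The colour of a point of the lattice of translations, as a residue modulo `k`. -/
def color (p : ℤ × ℤ) : ℤ := (C.s * p.1 + C.t * p.2) % C.k

/-- Whether the point `(x, y)` lies in the convex body. -/
def bodyMem (x y : ℤ) : Bool :=
  forceInt x fun x => forceInt y fun y =>
    Nat.blt (4 * (x.natAbs * x.natAbs + y.natAbs * y.natAbs)) (C.R * C.R) &&
      C.strips.all fun n => Nat.ble (n.1 * x + n.2.1 * y).natAbs n.2.2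

/-- Whether the four corners of the grid cell with lower corner `I`, `J` lie in the convex body. -/
def cellMem (I J : ℤ) : Bool :=
  forceInt (C.gridX I J) fun x => forceInt (C.gridY I J) fun y =>
    C.bodyMem x y && C.bodyMem (x + C.u.1) (y + C.u.2) && C.bodyMem (x + C.v.1) (y + C.v.2) &&
      C.bodyMem (x + C.u.1 + C.v.1) (y + C.u.2 + C.v.2)

/-- The integer points of the square `[-w, w] × [-w, w]`. -/
def box (w : ℕ) : List (ℤ × ℤ) :=
  (List.range (2 * w + 1)).flatMap fun i : ℕ => (List.range (2 * w + 1)).map fun j : ℕ =>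
    ((i : ℤ) - w, (j : ℤ) - w)

/-- Every cell of a fundamental parallelogram has at least `m` translates inside the body. -/
def coversCheck : Bool :=
  (List.range C.N).all fun i => (List.range C.N).all fun j =>
    Nat.ble C.m ((box C.w).countP fun p => C.cellMem (i + C.N * p.1) (j + C.N * p.2))

/-- Whether the translate of the body by the grid vector with coordinates `I`, `J` is seen to be
at distance more than `R` from the body: either the vector has length at least `2 * R`, or one of
the strips separates the two. In the second case natural subtraction makes the right-hand side
zero when the strip and its translate overlap. -/
def gridFar (I J : ℤ) : Bool :=
  Nat.ble (4 * C.R ^ 2) ((C.gridX I J).natAbs ^ 2 + (C.gridY I J).natAbs ^ 2) ||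
  C.strips.any fun n =>
    Nat.blt (C.R ^ 2 * (n.1.natAbs ^ 2 + n.2.1.natAbs ^ 2))
      (((n.1 * C.gridX I J + n.2.1 * C.gridY I J).natAbs - 2 * n.2.2) ^ 2)

/-- The body is far from its translates by the nonzero lattice vectors of colour zero with
coordinates at most `a`. -/
def separatesCheck : Bool :=
  (box C.a).all fun p =>
    (p.1.natAbs == 0 && p.2.natAbs == 0) || !((C.color p).natAbs == 0) ||
      C.gridFar (C.N * p.1) (C.N * p.2)

/-- The bound `a` is large enough: a lattice vector with a larger coordinate has length at least
`2 * R`. -/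
def windowCheck : Bool :=
  Nat.ble (4 * C.R ^ 2 * (C.u.1.natAbs ^ 2 + C.u.2.natAbs ^ 2))
      ((C.N * C.det.natAbs * (C.a + 1)) ^ 2) &&
  Nat.ble (4 * C.R ^ 2 * (C.v.1.natAbs ^ 2 + C.v.2.natAbs ^ 2))
      ((C.N * C.det.natAbs * (C.a + 1)) ^ 2)

/-- The finite computation that certifies a proper `m`-fold colouring with `k` colours. -/
def check : Bool :=
  Nat.blt 0 C.k && Nat.blt 0 C.N && Nat.blt 0 C.R && Nat.blt 0 C.det.natAbs &&
    C.windowCheck && C.separatesCheck && C.coversCheck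

/-! ### From the checks to a colouring -/

/-- The point with real coordinates `X`, `Y` with respect to the basis of the fine grid. -/
noncomputable def point (X Y : ℝ) : Plane :=
  !₂[X * C.u.1 + Y * C.v.1, X * C.u.2 + Y * C.v.2]

/-- The convex body whose translates make up the colour classes. -/
def body : Set Plane :=
  {y | 2 * ‖y‖ < C.R ∧ ∀ n ∈ C.strips, |(n.1 : ℝ) * y 0 + n.2.1 * y 1| ≤ n.2.2}

/-- The point of the lattice of translations with coordinates `p`. -/
noncomputable def site (p : ℤ × ℤ) : Plane := C.point (C.N * p.1) (C.N * p.2)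

@[simp] theorem point_zero_coord (X Y : ℝ) : C.point X Y 0 = X * C.u.1 + Y * C.v.1 := by
  simp [point]

@[simp] theorem point_one_coord (X Y : ℝ) : C.point X Y 1 = X * C.u.2 + Y * C.v.2 := by
  simp [point]

theorem exists_point_eq (hdet : C.det ≠ 0) (x : Plane) : ∃ X Y, x = C.point X Y := by
  have h : (C.u.1 * C.v.2 - C.u.2 * C.v.1 : ℝ) ≠ 0 := by exact_mod_cast hdet
  refine ⟨(x 0 * C.v.2 - x 1 * C.v.1) / (C.u.1 * C.v.2 - C.u.2 * C.v.1),
    (x 1 * C.u.1 - x 0 * C.u.2) / (C.u.1 * C.v.2 - C.u.2 * C.v.1), ?_⟩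
  apply plane_ext <;>
    simp only [point_zero_coord, point_one_coord] <;>
    rw [div_mul_eq_mul_div, div_mul_eq_mul_div, ← add_div, eq_div_iff h] <;> ring

theorem convex_body : Convex ℝ C.body := by
  have h : C.body = Metric.ball 0 (C.R / 2 : ℝ) ∩
      ⋂ n ∈ C.strips, {y : Plane | |(n.1 : ℝ) * y 0 + n.2.1 * y 1| ≤ n.2.2} := by
    ext y
    simp only [body, Set.mem_ofPred_eq, Set.mem_inter_iff, mem_ball_zero_iff, Set.mem_iInter]
    rw [lt_div_iff₀ two_pos, mul_comm]
  rw [h]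
  refine (convex_ball _ _).inter (convex_iInter₂ fun n _ => ?_)
  intro x hx y hy a b ha hb hab
  simp only [Set.mem_ofPred_eq, PiLp.add_apply, PiLp.smul_apply, smul_eq_mul] at hx hy ⊢
  rw [abs_le] at *
  constructor <;> nlinarith

theorem mem_body_of_bodyMem {x y : ℤ} (h : C.bodyMem x y = true) {z : Plane}
    (hx : z 0 = x) (hy : z 1 = y) : z ∈ C.body := by
  simp only [bodyMem, forceInt_eq, Bool.and_eq_true, List.all_eq_true, Nat.blt_eq,
    Nat.ble_eq] at h
  obtain ⟨h1, h2⟩ := h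
  refine ⟨lt_of_pow_lt_pow_left₀ 2 (by positivity) ?_, fun n hn => ?_⟩
  · rw [mul_pow, plane_norm_sq, hx, hy]
    have : (4 * (x ^ 2 + y ^ 2) : ℤ) < C.R ^ 2 := by
      zify at h1; simpa only [← sq, sq_abs] using h1
    have := (Int.cast_lt (R := ℝ)).2 this
    push_cast at this; linarith
  · rw [hx, hy]
    have := h2 n hn
    zify at this
    exact_mod_cast this

/-- A cell with its corners in the body lies in the body, by convexity. -/
theorem mem_body_of_cellMem {I J : ℤ} (h : C.cellMem I J = true) {X Y : ℝ}
    (hX0 : 0 ≤ X) (hX1 : X ≤ 1) (hY0 : 0 ≤ Y) (hY1 : Y ≤ 1) :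
    C.point (I + X) (J + Y) ∈ C.body := by
  simp only [cellMem, forceInt_eq, Bool.and_eq_true] at h
  obtain ⟨⟨⟨h00, h10⟩, h01⟩, h11⟩ := h
  have p00 : C.point I J ∈ C.body :=
    C.mem_body_of_bodyMem h00 (by simp [gridX]) (by simp [gridY])
  have p10 : C.point (I + 1) J ∈ C.body :=
    C.mem_body_of_bodyMem h10 (by simp [gridX]; ring) (by simp [gridY]; ring)
  have p01 : C.point I (J + 1) ∈ C.body :=
    C.mem_body_of_bodyMem h01 (by simp [gridX]; ring) (by simp [gridY]; ring)
  have p11 : C.point (I + 1) (J + 1) ∈ C.body :=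
    C.mem_body_of_bodyMem h11 (by simp [gridX]; ring) (by simp [gridY]; ring)
  have key : ∀ y : ℝ, C.point I y ∈ C.body → C.point (I + 1) y ∈ C.body →
      C.point (I + X) y ∈ C.body := by
    intro y h0 h1
    convert C.convex_body h0 h1 (sub_nonneg.2 hX1) hX0 (by ring) using 1
    apply plane_ext <;> simp <;> ring
  convert C.convex_body (key J p00 p10) (key (J + 1) p01 p11) (sub_nonneg.2 hY1) hY0
    (by ring) using 1
  apply plane_ext <;> simp <;> ring

theorem mem_box {w : ℕ} {p : ℤ × ℤ} : p ∈ box w ↔ |p.1| ≤ w ∧ |p.2| ≤ w := by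
  have key : ∀ z : ℤ, (∃ i < 2 * w + 1, (i : ℤ) - w = z) ↔ |z| ≤ w := by
    intro z
    rw [abs_le]
    constructor
    · rintro ⟨i, hi, rfl⟩; omega
    · intro h; exact ⟨(z + w).toNat, by omega, by omega⟩
  obtain ⟨p, q⟩ := p
  rw [← key, ← key]
  simp only [box, List.mem_flatMap, List.mem_map, List.mem_range, Prod.mk.injEq]
  constructor
  · rintro ⟨i, hi, j, hj, h1, h2⟩; exact ⟨⟨i, hi, h1⟩, j, hj, h2⟩
  · rintro ⟨⟨i, hi, h1⟩, j, hj, h2⟩; exact ⟨i, hi, j, hj, h1, h2⟩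

theorem nodup_box (w : ℕ) : (box w).Nodup := by
  rw [box, List.nodup_flatMap]
  constructor
  · intro i _
    refine List.nodup_range.map ?_
    intro a b h; simpa using h
  · refine List.nodup_range.imp ?_
    intro i j hij
    simp only [Function.onFun, List.disjoint_left, List.mem_map, not_exists, not_and]
    rintro x ⟨a, _, rfl⟩ b _ h
    simp only [Prod.mk.injEq, sub_left_inj, Nat.cast_inj] at h
    exact hij h.1.symm

theorem far_of_gridFar {I J : ℤ} (h : C.gridFar I J = true) :
    2 * C.R ≤ ‖C.point I J‖ ∨ ∃ n ∈ C.strips,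
      2 * (n.2.2 : ℝ) + √((n.1 : ℝ) ^ 2 + (n.2.1 : ℝ) ^ 2) * C.R <
        |(n.1 : ℝ) * C.point I J 0 + n.2.1 * C.point I J 1| := by
  simp only [gridFar, Bool.or_eq_true, List.any_eq_true, Nat.blt_eq, Nat.ble_eq] at h
  have hx : C.point I J 0 = (C.gridX I J : ℝ) := by simp [gridX]
  have hy : C.point I J 1 = (C.gridY I J : ℝ) := by simp [gridY]
  rcases h with h | ⟨n, hn, h⟩
  · left
    refine le_of_sq_le_sq ?_ (norm_nonneg _)
    rw [plane_norm_sq, hx, hy]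
    zify at h
    simp only [sq_abs] at h
    have := (Int.cast_le (R := ℝ)).2 h
    push_cast at this; linarith
  · right
    refine ⟨n, hn, ?_⟩
    rw [hx, hy]
    set d := (n.1 * C.gridX I J + n.2.1 * C.gridY I J).natAbs with hd
    have hdc : 2 * n.2.2 < d := by
      by_contra hle
      rw [Nat.sub_eq_zero_of_le (not_lt.1 hle)] at h
      simp at h
    have hdr : |(n.1 : ℝ) * C.gridX I J + n.2.1 * C.gridY I J| = d := by
      rw [hd, Nat.cast_natAbs]; push_cast; rfl
    rw [hdr, ← lt_sub_iff_add_lt']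
    have hpos : (0 : ℝ) ≤ d - 2 * n.2.2 := by
      have : ((2 * n.2.2 : ℕ) : ℝ) < d := by exact_mod_cast hdc
      push_cast at this; linarith
    refine lt_of_pow_lt_pow_left₀ 2 hpos ?_
    rw [mul_pow, Real.sq_sqrt (by positivity)]
    zify [hdc.le] at h
    simp only [sq_abs] at h
    have := (Int.cast_lt (R := ℝ)).2 h
    push_cast at this; linarith

/-- By Cramer's rule a large coordinate forces a large norm. -/
theorem norm_site_ge_of_notMem_box (hN : 0 < C.N) (hdet : C.det ≠ 0) (hd : C.windowCheck = true)
    {p : ℤ × ℤ} (hp : p ∉ box C.a) : 2 * C.R ≤ ‖C.site p‖ := by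
  simp only [windowCheck, Bool.and_eq_true, Nat.ble_eq] at hd
  obtain ⟨hu, hv⟩ := hd
  refine le_of_sq_le_sq ?_ (norm_nonneg _)
  rw [plane_norm_sq]
  set x := C.site p 0 with hx
  set y := C.site p 1 with hy
  have hND : (C.N * C.det : ℝ) ≠ 0 :=
    mul_ne_zero (by exact_mod_cast hN.ne') (by exact_mod_cast hdet)
  -- One coordinate `z` of `p` up to sign, with `e` the basis vector belonging to the other coordinate.
  have key : ∀ (e : ℤ × ℤ) (z : ℤ), (C.a : ℤ) < |z| →
      4 * C.R ^ 2 * (e.1.natAbs ^ 2 + e.2.natAbs ^ 2) ≤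
        (C.N * C.det.natAbs * (C.a + 1)) ^ 2 →
      x * e.2 - y * e.1 = C.N * C.det * z → (2 * C.R : ℝ) ^ 2 ≤ x ^ 2 + y ^ 2 := by
    intro e z hz he heq
    have hz0 : (z : ℝ) ≠ 0 := by
      have : z ≠ 0 := by rintro rfl; simp at hz; omega
      exact_mod_cast this
    have he' : (4 * C.R ^ 2 * (e.1 ^ 2 + e.2 ^ 2) : ℝ) ≤ (C.N * C.det * (C.a + 1)) ^ 2 := by
      zify at he
      rw [mul_pow, mul_pow, sq_abs, sq_abs, sq_abs, ← mul_pow, ← mul_pow] at he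
      exact_mod_cast he
    have hz' : ((C.a : ℝ) + 1) ^ 2 ≤ (z : ℝ) ^ 2 := by
      rw [← sq_abs (z : ℝ)]
      gcongr
      exact_mod_cast hz
    have hcs : (C.N * C.det * z : ℝ) ^ 2 ≤ (x ^ 2 + y ^ 2) * (e.1 ^ 2 + e.2 ^ 2) := by
      rw [← heq]; nlinarith [sq_nonneg (x * e.1 + y * e.2)]
    have hpe : (0 : ℝ) < e.1 ^ 2 + e.2 ^ 2 := by
      refine lt_of_le_of_ne (by positivity) fun h0 => ?_
      rw [← h0, mul_zero] at hcs
      exact absurd hcs (not_le.2 (by positivity))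
    have : (C.N * C.det * (C.a + 1) : ℝ) ^ 2 ≤ (C.N * C.det * z) ^ 2 := by
      rw [mul_pow, mul_pow _ (z : ℝ)]; gcongr
    refine le_of_mul_le_mul_right ?_ hpe
    linarith
  rw [mem_box, not_and_or, not_le, not_le] at hp
  rcases hp with h | h
  · refine key C.v p.1 h hv ?_
    simp [hx, hy, site, det]; ring
  · refine key C.u (-p.2) (by rwa [abs_neg]) hu ?_
    simp [hx, hy, site, det]; ring

theorem far_of_color_eq_zero (hN : 0 < C.N) (hdet : C.det ≠ 0) (hw : C.windowCheck = true)
    (hs : C.separatesCheck = true) {p : ℤ × ℤ} (hp : p ≠ 0) (hc : C.color p = 0) :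
    2 * C.R ≤ ‖C.site p‖ ∨ ∃ n ∈ C.strips,
      2 * (n.2.2 : ℝ) + √((n.1 : ℝ) ^ 2 + (n.2.1 : ℝ) ^ 2) * C.R <
        |(n.1 : ℝ) * C.site p 0 + n.2.1 * C.site p 1| := by
  by_cases hb : p ∈ box C.a
  · simp only [separatesCheck, List.all_eq_true] at hs
    have h := hs p hb
    have h0 : ¬(p.1 = 0 ∧ p.2 = 0) := fun h => hp (Prod.ext h.1 h.2)
    simp only [Bool.or_eq_true, Bool.and_eq_true, beq_iff_eq, Int.natAbs_eq_zero, h0, hc,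
      Bool.not_eq_true', false_or, Int.natAbs_zero, beq_self_eq_true, Bool.true_eq_false] at h
    simpa [site] using C.far_of_gridFar h
  · exact Or.inl (C.norm_site_ge_of_notMem_box hN hdet hw hb)

theorem site_sub (p q : ℤ × ℤ) : C.site (p - q) = C.site p - C.site q := by
  apply plane_ext <;> simp [site] <;> ring

theorem color_sub_eq_zero {p q : ℤ × ℤ} (h : C.color p = C.color q) : C.color (p - q) = 0 := by
  simp only [color] at *
  rw [← Int.emod_eq_emod_iff_emod_sub_eq_zero.1 h]
  congr 1
  simp; ring

/-- The translates of the body of one colour are more than `R` apart. For `x = y` this says that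
the translates containing a given point have distinct colours; for `x` and `y` at distance `R`,
that points of one colour at this distance lie in the same translate. -/
theorem eq_of_color_eq (hN : 0 < C.N) (hdet : C.det ≠ 0) (hw : C.windowCheck = true)
    (hs : C.separatesCheck = true) {p q : ℤ × ℤ} (hc : C.color p = C.color q)
    {x y : Plane} (hx : x - C.site p ∈ C.body) (hy : y - C.site q ∈ C.body)
    (hxy : ‖x - y‖ ≤ C.R) : p = q := by
  by_contra hne
  have hsite : C.site (p - q) = (x - y) - ((x - C.site p) - (y - C.site q)) := by
    rw [site_sub]; abel
  set x' := x - C.site p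
  set y' := y - C.site q
  -- Now the distance of `x` and `y` is compared with the length of `site (p - q)`, or with its
  -- component across a separating strip.
  rcases C.far_of_color_eq_zero hN hdet hw hs (sub_ne_zero.2 hne) (C.color_sub_eq_zero hc) with
    h | ⟨n, hn, h⟩
  · have h1 : ‖C.site (p - q)‖ ≤ ‖x - y‖ + (‖x'‖ + ‖y'‖) := by
      rw [hsite]
      exact (norm_sub_le _ _).trans (by gcongr; exact norm_sub_le _ _)
    linarith [hx.1, hy.1]
  · have h1 := hx.2 n hn
    have h2 := hy.2 n hn
    have h3 := (abs_pairing_le n.1 n.2.1 (x - y)).trans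
      (mul_le_mul_of_nonneg_left hxy (Real.sqrt_nonneg _))
    have h4 : (n.1 : ℝ) * C.site (p - q) 0 + n.2.1 * C.site (p - q) 1 =
        (n.1 * (x - y) 0 + n.2.1 * (x - y) 1) - (n.1 * x' 0 + n.2.1 * x' 1) +
          (n.1 * y' 0 + n.2.1 * y' 1) := by
      rw [hsite]; simp only [PiLp.sub_apply]; ring
    rw [h4] at h
    rw [abs_le] at h1 h2 h3
    exact absurd h (not_lt.2 (abs_le.2 ⟨by linarith, by linarith⟩))

/-- Every point lies in at least `m` translates of the body. -/
theorem exists_sites (hN : 0 < C.N) (hdet : C.det ≠ 0) (hc : C.coversCheck = true) (x : Plane) :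
    ∃ F : Finset (ℤ × ℤ), C.m ≤ F.card ∧ ∀ p ∈ F, x - C.site p ∈ C.body := by
  obtain ⟨X, Y, rfl⟩ := C.exists_point_eq hdet x
  have hN' : (0 : ℤ) < C.N := by exact_mod_cast hN
  have hmod : ∀ z : ℝ, ∃ i < C.N, ∃ a : ℤ, ∃ f : ℝ, 0 ≤ f ∧ f ≤ 1 ∧ z = i + C.N * a + f := by
    intro z
    refine ⟨(⌊z⌋ % C.N).toNat, ?_, ⌊z⌋ / C.N, Int.fract z, Int.fract_nonneg z,
      (Int.fract_lt_one z).le, ?_⟩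
    · have := Int.emod_lt_of_pos ⌊z⌋ hN'; omega
    · have h1 : (((⌊z⌋ % C.N).toNat : ℤ) : ℤ) + C.N * (⌊z⌋ / C.N) = ⌊z⌋ := by
        rw [Int.toNat_of_nonneg (Int.emod_nonneg _ hN'.ne'), Int.emod_add_mul_ediv]
      have h2 := congrArg (Int.cast (R := ℝ)) h1
      push_cast at h2
      rw [h2, Int.floor_add_fract]
  obtain ⟨i, hi, a, f, hf0, hf1, rfl⟩ := hmod X
  obtain ⟨j, hj, b, g, hg0, hg1, rfl⟩ := hmod Y
  simp only [coversCheck, List.all_eq_true, List.mem_range, Nat.ble_eq] at hc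
  have hcount := hc i hi j hj
  rw [List.countP_eq_length_filter] at hcount
  set l := (box C.w).filter fun p => C.cellMem (i + C.N * p.1) (j + C.N * p.2) with hl
  have hnd : l.Nodup := (nodup_box _).filter _
  -- The cell `(i, j)` moved by `q` is the cell of `x` moved by `q - (a, b)`.
  refine ⟨l.toFinset.map (Equiv.subLeft (a, b)).toEmbedding, ?_, ?_⟩
  · rw [Finset.card_map, List.toFinset_card_of_nodup hnd]; exact hcount
  · intro p hp
    simp only [Finset.mem_map, List.mem_toFinset] at hp
    obtain ⟨q, hq, rfl⟩ := hp
    have hq' := (List.mem_filter.1 hq).2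
    convert C.mem_body_of_cellMem hq' hf0 hf1 hg0 hg1 using 1
    apply plane_ext <;> simp [site] <;> ring

theorem mem_sufficientColors (h : C.check = true) : C.k ∈ sufficientColors C.m := by
  simp only [check, Bool.and_eq_true, Nat.blt_eq] at h
  obtain ⟨⟨⟨⟨⟨⟨hk, hN⟩, hR⟩, hdet⟩, hw⟩, hs⟩, hc⟩ := h
  have hdet : C.det ≠ 0 := Int.natAbs_pos.1 hdet
  have hk' : (0 : ℤ) < C.k := by exact_mod_cast hk
  have hR' : (0 : ℝ) < C.R := by exact_mod_cast hR
  let col : ℤ × ℤ → Fin C.k := fun p =>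
    ⟨(C.color p).toNat, by have := Int.emod_lt_of_pos (C.s * p.1 + C.t * p.2) hk'
                           unfold color; omega⟩
  have hcol : ∀ {p q}, col p = col q → C.color p = C.color q := by
    intro p q hpq
    have h1 : (C.color p).toNat = (C.color q).toNat := congrArg Fin.val hpq
    have h2 : 0 ≤ C.color p := Int.emod_nonneg _ hk'.ne'
    have h3 : 0 ≤ C.color q := Int.emod_nonneg _ hk'.ne'
    omega
  have hex : ∀ x : Plane, ∃ T : Finset (Fin C.k), T.card = C.m ∧
      ∀ t ∈ T, ∃ p, col p = t ∧ (C.R : ℝ) • x - C.site p ∈ C.body := by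
    intro x
    obtain ⟨F, hF, hmem⟩ := C.exists_sites hN hdet hc ((C.R : ℝ) • x)
    have hinj : Set.InjOn col F := fun p hp q hq hpq =>
      C.eq_of_color_eq hN hdet hw hs (hcol hpq) (hmem p hp) (hmem q hq) (by simp)
    obtain ⟨T, hTF, hT⟩ := Finset.exists_subset_card_eq
      (hF.trans_eq (Finset.card_image_of_injOn hinj).symm)
    refine ⟨T, hT, fun t ht => ?_⟩
    obtain ⟨p, hp, rfl⟩ := Finset.mem_image.1 (hTF ht)
    exact ⟨p, rfl, hmem p hp⟩
  -- No compatibility between the choices at different points is needed: the colours available at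
  -- two points at unit distance are already disjoint.
  choose c hcard hcmem using hex
  refine ⟨c, hcard, fun x y hxy => Finset.disjoint_left.2 fun t hx hy => ?_⟩
  obtain ⟨p, rfl, hp⟩ := hcmem x t hx
  obtain ⟨q, hpq, hq⟩ := hcmem y _ hy
  have hnorm : ‖(C.R : ℝ) • x - (C.R : ℝ) • y‖ = C.R := by
    rw [← smul_sub, norm_smul, ← dist_eq_norm, hxy, mul_one, Real.norm_of_nonneg hR'.le]
  obtain rfl := C.eq_of_color_eq hN hdet hw hs (hcol hpq) hq hp
    (by rw [norm_sub_rev, hnorm])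
  have hdiff : (C.R : ℝ) • x - (C.R : ℝ) • y =
      ((C.R : ℝ) • x - C.site q) - ((C.R : ℝ) • y - C.site q) := by abel
  have := norm_sub_le ((C.R : ℝ) • x - C.site q) ((C.R : ℝ) • y - C.site q)
  rw [← hdiff, hnorm] at this
  linarith [hp.1, hq.1]

end LatticeColoring

/-! ### Explicit lattices

The lattices `L` are roughly hexagonal with shortest vectors of length about `2`, and the strips are
roughly perpendicular to these vectors and about as wide as the separation of `B` from its
neighbours permits. The exact numbers come from a numerical maximization of the distance from the
corners of the counted cells to the boundary of `B`; only the inequalities behind `check` matter.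
-/

theorem sufficientColors_1 : 7 ∈ sufficientColors 1 :=
  LatticeColoring.mem_sufficientColors
    ⟨7, 1, 3, 1000, (-46, -239), (-185, 160), 4, 2,
      [(100, -1, 47050), (52, 85, 46389), (48, -88, 46996)], 3, 1⟩
    (by decide +kernel)

theorem sufficientColors_2 : 12 ∈ sufficientColors 2 :=
  LatticeColoring.mem_sufficientColors
    ⟨12, 2, 6, 1000, (65, 24), (-58, 96), 1, 4,
      [(100, -3, 45377), (31, 95, 45507), (55, -84, 51083)], 4, 2⟩
    (by decide +kernel)

theorem sufficientColors_3 : 17 ∈ sufficientColors 3 :=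
  LatticeColoring.mem_sufficientColors
    ⟨17, 3, 7, 1000, (-32, 29), (-56, -73), 2, 12,
      [(99, 12, 44427), (53, 85, 48923), (53, -85, 48625)], 6, 2⟩
    (by decide +kernel)

theorem sufficientColors_4 : 22 ∈ sufficientColors 4 :=
  LatticeColoring.mem_sufficientColors
    ⟨22, 4, 9, 3000, (-125, 27), (-14, 134), 1, 5,
      [(99, -14, 122286), (43, 90, 147945), (38, -92, 147277)], 5, 2⟩
    (by decide +kernel)

theorem sufficientColors_5 : 26 ∈ sufficientColors 5 :=
  LatticeColoring.mem_sufficientColors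
    ⟨26, 5, 23, 100000, (-395, 1446), (-1694, 289), 5, 1,
      [(100, 4, 4282297), (51, 86, 5022149), (39, -92, 4604399)], 6, 2⟩
    (by decide +kernel)

theorem sufficientColors_6 : 31 ∈ sufficientColors 6 :=
  LatticeColoring.mem_sufficientColors
    ⟨31, 6, 8, 1000, (36, 7), (6, 46), 1, 7,
      [(999, -36, 482759), (446, 895, 469402), (567, -824, 424227)], 7, 2⟩
    (by decide +kernel)

theorem sufficientColors_7 : 36 ∈ sufficientColors 7 :=
  LatticeColoring.mem_sufficientColors
    ⟨36, 7, 6, 3000, (98, 119), (-74, 143), 5, 6,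
      [(100, 4, 137268), (51, 86, 149770), (44, -90, 139998)], 7, 2⟩
    (by decide +kernel)

theorem sufficientColors_8 : 40 ∈ sufficientColors 8 :=
  LatticeColoring.mem_sufficientColors
    ⟨40, 8, 7, 3000, (43, 73), (-156, 91), 4, 5,
      [(100, 2, 143627), (50, 87, 147018), (47, -88, 142165)], 10, 3⟩
    (by decide +kernel)

theorem sufficientColors_9 : 45 ∈ sufficientColors 9 :=
  LatticeColoring.mem_sufficientColors
    ⟨45, 9, 9, 10000, (-69, -294), (-296, 84), 38, 2,
      [(100, 7, 493276), (52, 86, 480486), (51, -86, 491987)], 7, 2⟩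
    (by decide +kernel)

theorem sufficientColors_10 : 49 ∈ sufficientColors 10 :=
  LatticeColoring.mem_sufficientColors
    ⟨49, 10, 12, 10000, (-62, 172), (-223, -143), 6, 44,
      [(100, -1, 488787), (52, 85, 487812), (38, -92, 455933)], 9, 3⟩
    (by decide +kernel)

theorem sufficientColors_11 : 54 ∈ sufficientColors 11 :=
  LatticeColoring.mem_sufficientColors
    ⟨54, 11, 9, 10000, (131, 207), (251, -173), 6, 49,
      [(100, -2, 472377), (57, 82, 490535), (50, -87, 449766)], 9, 3⟩
    (by decide +kernel)

theorem sufficientColors_12 : 59 ∈ sufficientColors 12 :=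
  LatticeColoring.mem_sufficientColors
    ⟨59, 12, 9, 3000, (-51, 47), (62, 66), 5, 7,
      [(100, 2, 150129), (54, 84, 141054), (53, -85, 141930)], 9, 3⟩
    (by decide +kernel)

theorem sufficientColors_13 : 63 ∈ sufficientColors 13 :=
  LatticeColoring.mem_sufficientColors
    ⟨63, 13, 8, 10000, (136, 233), (255, -166), 7, 58,
      [(100, 0, 485999), (50, 87, 472833), (49, -87, 472698)], 9, 3⟩
    (by decide +kernel)

theorem sufficientColors_14 : 68 ∈ sufficientColors 14 :=
  LatticeColoring.mem_sufficientColors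
    ⟨68, 14, 8, 3000, (-59, 9), (29, 110), 1, 12,
      [(100, 0, 144799), (55, 84, 149257), (50, -87, 131339)], 12, 4⟩
    (by decide +kernel)

theorem sufficientColors_15 : 73 ∈ sufficientColors 15 :=
  LatticeColoring.mem_sufficientColors
    ⟨73, 15, 7, 10000, (-24, 228), (-408, 33), 7, 1,
      [(100, -3, 491006), (51, 86, 459439), (45, -89, 472990)], 12, 4⟩
    (by decide +kernel)

theorem sufficientColors_16 : 77 ∈ sufficientColors 16 :=
  LatticeColoring.mem_sufficientColors
    ⟨77, 16, 8, 10000, (-218, 109), (107, 246), 4, 9,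
      [(100, 4, 455648), (54, 84, 463076), (54, -84, 468116)], 10, 3⟩
    (by decide +kernel)

theorem sufficientColors_17 : 82 ∈ sufficientColors 17 :=
  LatticeColoring.mem_sufficientColors
    ⟨82, 17, 7, 10000, (229, -147), (-188, -235), 77, 74,
      [(100, -3, 469985), (42, 91, 447540), (51, -86, 500018)], 10, 3⟩
    (by decide +kernel)

theorem sufficientColors_18 : 87 ∈ sufficientColors 18 :=
  LatticeColoring.mem_sufficientColors
    ⟨87, 18, 5, 10000, (296, -196), (-317, -313), 82, 79,
      [(100, -4, 487880), (54, 84, 481025), (50, -86, 483826)], 11, 3⟩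
    (by decide +kernel)

theorem sufficientColors_19 : 91 ∈ sufficientColors 19 :=
  LatticeColoring.mem_sufficientColors
    ⟨91, 19, 6, 3000, (-91, 47), (-5, 102), 5, 11,
      [(100, 1, 142771), (51, 86, 141865), (54, -84, 142224)], 11, 3⟩
    (by decide +kernel)

theorem sufficientColors_20 : 96 ∈ sufficientColors 20 :=
  LatticeColoring.mem_sufficientColors
    ⟨96, 20, 7, 3000, (-64, 8), (-9, 101), 1, 13,
      [(100, 2, 137999), (47, 88, 151884), (47, -88, 143432)], 13, 4⟩
    (by decide +kernel)

theorem sufficientColors_21 : 100 ∈ sufficientColors 21 :=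
  LatticeColoring.mem_sufficientColors
    ⟨100, 21, 6, 3000, (-2, -76), (-107, 17), 91, 2,
      [(100, -3, 140041), (46, 89, 137446), (51, -86, 146827)], 13, 4⟩
    (by decide +kernel)

theorem sufficientColors_22 : 105 ∈ sufficientColors 22 :=
  LatticeColoring.mem_sufficientColors
    ⟨105, 22, 6, 10000, (-214, 107), (112, 348), 4, 13,
      [(100, 2, 468906), (48, 88, 478505), (52, -85, 464808)], 14, 4⟩
    (by decide +kernel)

theorem sufficientColors_23 : 110 ∈ sufficientColors 23 :=
  LatticeColoring.mem_sufficientColors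
    ⟨110, 23, 5, 3000, (-6, 83), (129, 37), 9, 4,
      [(100, 2, 146225), (51, 86, 142835), (52, -86, 145261)], 14, 4⟩
    (by decide +kernel)

theorem sufficientColors_24 : 111 ∈ sufficientColors 24 :=
  LatticeColoring.mem_sufficientColors
    ⟨111, 24, 12, 10000, (65, 138), (90, -126), 11, 101,
      [(9991, 416, 48298179), (5185, 8551, 46460545), (5647, -8253, 47517479)], 12, 4⟩
    (by decide +kernel)

/-! ### The bound for all `m` -/

/-- Rounded down so far that `7` times it still exceeds `36 - 3.501`, the tightest instance of the
bound. -/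
theorem le_hexagonal_ratio : (4.64272 : ℝ) ≤ (1 + 2 / √3) ^ 2 := by
  have h3 : √3 ≤ 1.732051 := by
    rw [Real.sqrt_le_left (by norm_num)]; norm_num
  have hpos : (0 : ℝ) < √3 := by positivity
  have h : 2 / 1.732051 ≤ 2 / √3 := by gcongr
  have h' : (1 + 2 / 1.732051 : ℝ) ^ 2 ≤ (1 + 2 / √3) ^ 2 := by gcongr
  exact le_trans (by norm_num) h'

theorem exists_sufficientColors_lt (m : ℕ) (hm : 1 ≤ m) :
    ∃ k ∈ sufficientColors m, (k : ℝ) < (1 + 2 / √3) ^ 2 * m + 3.501 := by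
  have hα := le_hexagonal_ratio
  generalize (1 + 2 / √3 : ℝ) ^ 2 = α at hα
  induction m using Nat.strong_induction_on with
  | _ m ih =>
    by_cases h : m ≤ 24
    · interval_cases m
      · exact ⟨7, sufficientColors_1, by norm_num; linarith⟩
      · exact ⟨12, sufficientColors_2, by norm_num; linarith⟩
      · exact ⟨17, sufficientColors_3, by norm_num; linarith⟩
      · exact ⟨22, sufficientColors_4, by norm_num; linarith⟩
      · exact ⟨26, sufficientColors_5, by norm_num; linarith⟩
      · exact ⟨31, sufficientColors_6, by norm_num; linarith⟩
      · exact ⟨36, sufficientColors_7, by norm_num; linarith⟩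
      · exact ⟨40, sufficientColors_8, by norm_num; linarith⟩
      · exact ⟨45, sufficientColors_9, by norm_num; linarith⟩
      · exact ⟨49, sufficientColors_10, by norm_num; linarith⟩
      · exact ⟨54, sufficientColors_11, by norm_num; linarith⟩
      · exact ⟨59, sufficientColors_12, by norm_num; linarith⟩
      · exact ⟨63, sufficientColors_13, by norm_num; linarith⟩
      · exact ⟨68, sufficientColors_14, by norm_num; linarith⟩
      · exact ⟨73, sufficientColors_15, by norm_num; linarith⟩
      · exact ⟨77, sufficientColors_16, by norm_num; linarith⟩
      · exact ⟨82, sufficientColors_17, by norm_num; linarith⟩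
      · exact ⟨87, sufficientColors_18, by norm_num; linarith⟩
      · exact ⟨91, sufficientColors_19, by norm_num; linarith⟩
      · exact ⟨96, sufficientColors_20, by norm_num; linarith⟩
      · exact ⟨100, sufficientColors_21, by norm_num; linarith⟩
      · exact ⟨105, sufficientColors_22, by norm_num; linarith⟩
      · exact ⟨110, sufficientColors_23, by norm_num; linarith⟩
      · exact ⟨111, sufficientColors_24, by norm_num; linarith⟩
    · obtain ⟨k, hk, hlt⟩ := ih (m - 24) (by omega) (by omega)
      refine ⟨k + 111, ?_, ?_⟩
      · have := sufficientColors_add hk sufficientColors_24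
        rwa [Nat.sub_add_cancel (by omega)] at this
      · rw [Nat.cast_sub (by omega)] at hlt
        push_cast at hlt ⊢
        linarith

theorem multiChromaticNumber_mem {m : ℕ} (hm : 1 ≤ m) :
    multiChromaticNumber m ∈ sufficientColors m := by
  obtain ⟨k, hk, -⟩ := exists_sufficientColors_lt m hm
  exact Nat.sInf_mem ⟨k, hk⟩

theorem mainTheorem1 :
    (∀ m : ℕ, 1 ≤ m →
      IsLeast (sufficientColors m) (multiChromaticNumber m) ∧
      (multiChromaticNumber m : ℝ) < (1 + 2 / Real.sqrt 3) ^ 2 * (m : ℝ) + 3.501) ∧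
    (∀ m₁ m₂ : ℕ, 1 ≤ m₁ → 1 ≤ m₂ →
      multiChromaticNumber (m₁ + m₂) ≤ multiChromaticNumber m₁ + multiChromaticNumber m₂) ∧
    (3990 ∈ sufficientColors 860 ∧
      (3990 : ℝ) / 860 < (1 + 2 / Real.sqrt 3) ^ 2) := by
  refine ⟨fun m hm => ⟨⟨multiChromaticNumber_mem hm, fun k hk => Nat.sInf_le hk⟩, ?_⟩,
    fun m₁ m₂ h₁ h₂ => ?_, ?_, ?_⟩
  · obtain ⟨k, hk, hlt⟩ := exists_sufficientColors_lt m hm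
    exact lt_of_le_of_lt (Nat.cast_le.2 (Nat.sInf_le hk)) hlt
  · exact Nat.sInf_le
      (sufficientColors_add (multiChromaticNumber_mem h₁) (multiChromaticNumber_mem h₂))
  · exact sufficientColors_mono
      (sufficientColors_add (sufficientColors_mul sufficientColors_24 35) sufficientColors_20)
      (by norm_num)
  · exact lt_of_lt_of_le (by norm_num) le_hexagonal_ratio
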